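/- Let $F$ be a closed surface (a compact Hausdorff 2-manifold without boundary, possibly non-orientable) and let $D_F$ be an oriented link diagram in $F$, i.e. finitely many oriented closed curves in $F$, simple and disjoint except for finitely many transverse double points, called crossings, which carry over/under information. (For instance, $(F,D_F)$ may be a link diagram realization of a twisted link diagram $D$: the image of the abstract link diagram associated with $D$ under an embedding of its surface into $F$.) Apply an A-splice or a B-splice at each crossing of $D_F$. A splice that is compatible with the orientations creates no poles. A splice that is not compatible with them creates two poles: a sink pole on the arc joining the two incoming ends and a source pole on the arc joining the two outgoing ends, each pole lying on the side of its arc that faces the region between the two arcs. The result is a collection $s$ of mutually disjoint simple closed curves with poles (pole curves) in $F$; $(F,s)$ is called a surface pole state of $(F,D_F)$. A pole reduction removes from a pole curve a sink pole and a source pole that are adjacent along an arc of the curve and lie on the same side of this arc. The index $\iota(l)$ of a pole curve $l$ is half the number of poles of an irreducible pole curve (one to which no pole reduction applies) obtained from $l$ by pole reductions. Let $l$ be a pole curve of a surface pole state $(F,s)$ of $(F,D_F)$. If $\iota(l)>0$, then $l$ is not a separating curve in $F$; that is, the complement of $l$ in the connected component of $F$ containing $l$ (in $F$ itself if $F$ is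 connected) is connected. -/

import Mathlib

open Set Filter Topology

namespace TwistedLink

/-! ### Curves in a surface and their local sides -/

section Sides

variable {F : Type*} [TopologicalSpace F]

/-- `e` is a chart of the surface around `x`, modelled on the whole plane, in which the set `L` is
the horizontal axis. -/
def IsFlatChart (L : Set F) (x : F) (e : ℝ × ℝ → F) : Prop :=
  IsOpenEmbedding e ∧ e (0, 0) = x ∧ e ⁻¹' L = {p | p.2 = 0}

/-- Near the point `x` of the curve `L`, the set `W` is exactly one of the two local sides
of `L`. -/
def IsSideAt (L W : Set F) (x : F) : Prop :=
  ∃ e : ℝ × ℝ → F, IsFlatChart L x e ∧ e ⁻¹' W = {p | 0 < p.2}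

/-- A closed curve `L` is non-separating: removing it from the connected component of the surface
that contains it leaves a connected set. (If `F` is connected this says that `F \ L` is
connected.) -/
def IsNonSeparating (L : Set F) : Prop :=
  ∀ x ∈ L, IsConnected (connectedComponent x \ L)

/-- Just after time `t`, the curve `α` runs along the curve `β` followed forwards from
time `u`. -/
def SameDirection (α β : UnitAddCircle → F) (t u : UnitAddCircle) : Prop :=
  Tendsto (fun ε : ℝ => α (t + (ε : UnitAddCircle))) (𝓝[>] 0)
    (map (fun δ : ℝ => β (u + (δ : UnitAddCircle))) (𝓝[>] 0))

/-- Just after time `t`, the curve `α` runs along the curve `β` followed backwards from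
time `u`. -/
def OppositeDirection (α β : UnitAddCircle → F) (t u : UnitAddCircle) : Prop :=
  Tendsto (fun ε : ℝ => α (t + (ε : UnitAddCircle))) (𝓝[>] 0)
    (map (fun δ : ℝ => β (u - (δ : UnitAddCircle))) (𝓝[>] 0))

end Sides

/-! ### Pole curves, pole reductions, index -/

/-- Sink poles (I-poles) and source poles (O-poles). -/
inductive PoleKind where
  | sink
  | source

/-- A pole curve: a simple closed curve with finitely many poles on it. Every pole lies on one of
the two local sides of the curve. The arcs between the poles are oriented, both towards a sink
pole and both away from a source pole. -/
structure PoleCurve (F : Type*) [TopologicalSpace F] where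
  /-- a parametrization of the curve -/
  toFun : UnitAddCircle → F
  continuous_toFun : Continuous toFun
  injective_toFun : Function.Injective toFun
  /-- the parameters of the poles -/
  poles : Finset UnitAddCircle
  /-- the kinds of the poles (irrelevant at other parameters) -/
  kind : UnitAddCircle → PoleKind
  /-- a set which near the pole is the side on which the pole lies (irrelevant at other
  parameters, and relevant at a pole only up to equality near the pole) -/
  side : UnitAddCircle → Set F
  isSideAt_side : ∀ t ∈ poles, IsSideAt (range toFun) (side t) (toFun t)
  /-- the orientation off the poles: `true` if it is the one given by the parametrization -/
  dir : UnitAddCircle → Bool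
  dir_of_notMem : ∀ t, t ∉ poles → ∀ᶠ ε : ℝ in 𝓝 0, dir (t + (ε : UnitAddCircle)) = dir t
  dir_of_sink : ∀ t ∈ poles, kind t = PoleKind.sink → ∀ᶠ ε : ℝ in 𝓝[>] 0,
    dir (t - (ε : UnitAddCircle)) = true ∧ dir (t + (ε : UnitAddCircle)) = false
  dir_of_source : ∀ t ∈ poles, kind t = PoleKind.source → ∀ᶠ ε : ℝ in 𝓝[>] 0,
    dir (t - (ε : UnitAddCircle)) = false ∧ dir (t + (ε : UnitAddCircle)) = true

namespace PoleCurve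

variable {F : Type*} [TopologicalSpace F]

/-- The underlying simple closed curve. -/
def carrier (l : PoleCurve F) : Set F := range l.toFun

/-- The poles at `p` and `q` can be removed by a pole reduction: one is a sink and the other a
source, one of the two arcs of the curve between them (the one from `p` forwards to `q`) contains
no other pole, and both poles lie on the same side of this arc. -/
def IsReduciblePair (l : PoleCurve F) (p q : UnitAddCircle) : Prop :=
  p ∈ l.poles ∧ q ∈ l.poles ∧ l.kind p ≠ l.kind q ∧
    ∃ d : ℝ, 0 < d ∧ d < 1 ∧ q = p + (d : UnitAddCircle) ∧
      (∀ r : ℝ, 0 < r → r < d → p + (r : UnitAddCircle) ∉ l.poles) ∧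
      ∃ W : Set F,
        (∀ r : ℝ, 0 ≤ r → r ≤ d → IsSideAt l.carrier W (l.toFun (p + (r : UnitAddCircle)))) ∧
        (∀ᶠ y in 𝓝 (l.toFun p), y ∈ W ↔ y ∈ l.side p) ∧
        (∀ᶠ y in 𝓝 (l.toFun q), y ∈ W ↔ y ∈ l.side q)

/-- `l'` is obtained from `l` by one pole reduction. The orientation of `l'` is forced by its
poles, and arbitrary when no pole is left. -/
def Reduces (l l' : PoleCurve F) : Prop :=
  ∃ p q, l.IsReduciblePair p q ∧ l'.toFun = l.toFun ∧
    (∀ t, t ∈ l'.poles ↔ t ∈ l.poles ∧ t ≠ p ∧ t ≠ q) ∧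
    ∀ t ∈ l'.poles, l'.kind t = l.kind t ∧
      ∀ᶠ y in 𝓝 (l.toFun t), y ∈ l'.side t ↔ y ∈ l.side t

/-- No pole reduction can be applied. -/
def IsIrreducible (l : PoleCurve F) : Prop := ∀ p q, ¬ l.IsReduciblePair p q

/-- `ι(l) = k`: pole reductions lead from `l` to an irreducible pole curve with `2 k` poles. -/
def HasIndex (l : PoleCurve F) (k : ℕ) : Prop :=
  ∃ l' : PoleCurve F, Relation.ReflTransGen Reduces l l' ∧ l'.IsIrreducible ∧
    l'.poles.card = 2 * k

end PoleCurve

/-- A pole curve link: a finite collection of mutually disjoint pole curves. -/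
structure PoleCurveLink (F : Type*) [TopologicalSpace F] where
  /-- the number of pole curves -/
  n : ℕ
  curve : Fin n → PoleCurve F
  disjoint : ∀ i j, i ≠ j → Disjoint (curve i).carrier (curve j).carrier

/-- The union of the curves of a pole curve link. -/
def PoleCurveLink.carrier {F : Type*} [TopologicalSpace F] (s : PoleCurveLink F) : Set F :=
  ⋃ i, (s.curve i).carrier

/-! ### Link diagrams in a surface -/

/-- An (oriented) link diagram in a surface `F`: finitely many closed curves whose only
singularities are finitely many transverse double points, with over/under information there. -/
structure LinkDiagram (F : Type*) [TopologicalSpace F] where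
  /-- the number of components -/
  n : ℕ
  /-- the components, oriented by their parametrizations -/
  comp : Fin n → UnitAddCircle → F
  continuous_comp : ∀ k, Continuous (comp k)
  /-- the number of crossings -/
  m : ℕ
  /-- a neighbourhood of each crossing, identified with the plane, the crossing being the
  origin -/
  chart : Fin m → ℝ × ℝ → F
  isOpenEmbedding_chart : ∀ c, IsOpenEmbedding (chart c)
  disjoint_chart : ∀ c c', c ≠ c' → Disjoint (range (chart c)) (range (chart c'))
  /-- near a crossing the diagram consists of the two axes -/
  chart_preimage : ∀ c, chart c ⁻¹' (⋃ k, range (comp k)) = {p | p.1 = 0 ∨ p.2 = 0}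
  /-- the component and the time at which the horizontal axis is run through the crossing -/
  strandX : Fin m → Fin n × UnitAddCircle
  /-- the component and the time at which the vertical axis is run through the crossing -/
  strandY : Fin m → Fin n × UnitAddCircle
  /-- the two strands are the only ones through the crossing -/
  comp_eq_crossing : ∀ c k t, comp k t = chart c (0, 0) ↔ (k, t) = strandX c ∨ (k, t) = strandY c
  /-- both axes are run through in the positive direction -/
  strandX_out : ∀ c, Tendsto
    (fun ε : ℝ => comp (strandX c).1 ((strandX c).2 + (ε : UnitAddCircle))) (𝓝[>] 0)
    (map (fun r : ℝ => chart c (r, 0)) (𝓝[>] 0))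
  strandX_in : ∀ c, Tendsto
    (fun ε : ℝ => comp (strandX c).1 ((strandX c).2 - (ε : UnitAddCircle))) (𝓝[>] 0)
    (map (fun r : ℝ => chart c (-r, 0)) (𝓝[>] 0))
  strandY_out : ∀ c, Tendsto
    (fun ε : ℝ => comp (strandY c).1 ((strandY c).2 + (ε : UnitAddCircle))) (𝓝[>] 0)
    (map (fun r : ℝ => chart c (0, r)) (𝓝[>] 0))
  strandY_in : ∀ c, Tendsto
    (fun ε : ℝ => comp (strandY c).1 ((strandY c).2 - (ε : UnitAddCircle))) (𝓝[>] 0)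
    (map (fun r : ℝ => chart c (0, -r)) (𝓝[>] 0))
  /-- the horizontal strand is the over-strand (with respect to the local orientation of `F`
  for which `chart c` is positive; reversing both the local orientation and the roles of over
  and under describes the same crossing) -/
  xOver : Fin m → Bool
  /-- away from the crossings the curves are simple and disjoint ... -/
  simple : ∀ k t, (∀ c, comp k t ≠ chart c (0, 0)) →
    ∀ k' t', comp k' t' = comp k t → k' = k ∧ t' = t
  /-- ... and locally flat -/
  flat : ∀ k t, (∀ c, comp k t ≠ chart c (0, 0)) →
    ∃ e, IsFlatChart (⋃ k, range (comp k)) (comp k t) e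

/-! ### Splices and surface pole states -/

/-- The two kinds of splices. -/
inductive Splice where
  | A
  | B

/-- The two arcs replacing the axes in a splice that respects the orientations of the axes.
Outside the square `|x + y| ≤ 1`, `|x - y| ≤ 1` they coincide with the axes; they join the
negative horizontal half-axis to the positive vertical one, and the negative vertical half-axis
to the positive horizontal one. -/
def orientedArcs : Set (ℝ × ℝ) := {p | |p.1 - p.2| = max |p.1 + p.2| 1}

/-- The two arcs replacing the axes in a splice that does not respect the orientations of the
axes: they join the two negative half-axes, and the two positive ones. -/
def unorientedArcs : Set (ℝ × ℝ) := {p | |p.1 + p.2| = max |p.1 - p.2| 1}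

/-- The region between the two arcs of a splice that does not respect the orientations. Both
poles arising from the splice lie in it. -/
def middleRegion : Set (ℝ × ℝ) := {p | |p.1 + p.2| < max |p.1 - p.2| 1}

/-- The square inside which a splice changes the diagram. -/
def spliceSquare : Set (ℝ × ℝ) := {p | |p.1 + p.2| ≤ 1 ∧ |p.1 - p.2| ≤ 1}

namespace LinkDiagram

variable {F : Type*} [TopologicalSpace F]

/-- The union of the curves of the diagram. -/
def carrier (D : LinkDiagram F) : Set F := ⋃ k, range (D.comp k)

/-- Whether the splice of the given kind at the crossing `c` respects the orientations. An
A-splice joins the two regions swept out by the over-strand when it is turned counterclockwise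
onto the under-strand, a B-splice joins the two others. -/
def IsOrientedSplice (D : LinkDiagram F) (c : Fin D.m) : Splice → Prop
  | Splice.A => D.xOver c = true
  | Splice.B => D.xOver c = false

open Classical in
/-- The arcs by which a splice replaces the crossing, in the chart at the crossing. -/
noncomputable def spliceArcs (D : LinkDiagram F) (c : Fin D.m) (a : Splice) : Set (ℝ × ℝ) :=
  if D.IsOrientedSplice c a then orientedArcs else unorientedArcs

/-- The union of closed curves obtained from the diagram by splicing every crossing. -/
noncomputable def splicedCarrier (D : LinkDiagram F) (σ : Fin D.m → Splice) : Set F :=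
  (D.carrier \ ⋃ c, range (D.chart c)) ∪ ⋃ c, D.chart c '' D.spliceArcs c (σ c)

/-- The sink pole lies on the arc joining the two incoming half-axes. -/
noncomputable def sinkPoint (D : LinkDiagram F) (c : Fin D.m) : F := D.chart c (-(1 / 2), -(1 / 2))

/-- The source pole lies on the arc joining the two outgoing half-axes. -/
noncomputable def sourcePoint (D : LinkDiagram F) (c : Fin D.m) : F := D.chart c (1 / 2, 1 / 2)

/-- The pole curve link `s` is the result of applying the splices `σ` at the crossings of `D`:
its curves are those of the spliced diagram; its poles are a sink pole and a source pole for each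
splice that does not respect the orientations, both on the side of the region between the two
arcs; and away from the splices its orientation is that of `D`. -/
structure IsSpliceOf (D : LinkDiagram F) (σ : Fin D.m → Splice) (s : PoleCurveLink F) : Prop where
  carrier_eq : s.carrier = D.splicedCarrier σ
  mem_poles : ∀ i t, t ∈ (s.curve i).poles ↔ ∃ c, ¬ D.IsOrientedSplice c (σ c) ∧
    ((s.curve i).toFun t = D.sinkPoint c ∨ (s.curve i).toFun t = D.sourcePoint c)
  sink : ∀ i, ∀ t ∈ (s.curve i).poles, ∀ c, (s.curve i).toFun t = D.sinkPoint c →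
    (s.curve i).kind t = PoleKind.sink
  source : ∀ i, ∀ t ∈ (s.curve i).poles, ∀ c, (s.curve i).toFun t = D.sourcePoint c →
    (s.curve i).kind t = PoleKind.source
  side : ∀ i, ∀ t ∈ (s.curve i).poles, ∀ c,
    ((s.curve i).toFun t = D.sinkPoint c ∨ (s.curve i).toFun t = D.sourcePoint c) →
    ∀ᶠ y in 𝓝 ((s.curve i).toFun t), y ∈ (s.curve i).side t ↔ y ∈ D.chart c '' middleRegion
  dir : ∀ i t, (∀ c, (s.curve i).toFun t ∉ D.chart c '' spliceSquare) →
    ∀ k u, D.comp k u = (s.curve i).toFun t →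
      ((s.curve i).dir t = true → SameDirection (s.curve i).toFun (D.comp k) t u) ∧
      ((s.curve i).dir t = false → OppositeDirection (s.curve i).toFun (D.comp k) t u)

/-- `s` is a surface pole state of `D`: it results from an A-splice or a B-splice at each
crossing. -/
def IsSurfacePoleState (D : LinkDiagram F) (s : PoleCurveLink F) : Prop :=
  ∃ σ : Fin D.m → Splice, D.IsSpliceOf σ s

end LinkDiagram

end TwistedLink

/-! Suppose a curve of the state separates. Its complement then splits into disjoint open sets `U`
and `V`, both accumulating at every point of the curve, so each of its poles lies either on the `U`
side or on the `V` side. The proof evaluates the `excess`: sink poles minus source poles on the `U`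
side.

The excess vanishes (`excess_eq_zero`). The region between the two arcs of a splice against the
orientations is connected and misses all curves, so it lies in `U` or in `V`. It carries one sink
and one source, so over all curves the poles whose region lies in `U` cancel (`sum_sum_eq_zero`).
Any other curve lies wholly in `U` or in `V`; sinks and sources alternate along it, so it
contributes zero (`sum_sign_eq_zero`). Hence the separating curve contributes zero as well.

The excess also determines the index. A pole reduction removes two poles of opposite kinds on the
same side, so it preserves the excess (`Reduces.excess_eq`). On an irreducible separating curve
consecutive poles differ in kind and in side, so the excess is plus or minus half the number of
poles. Being zero, it leaves no poles (`poles_eq_empty`), and the index is 0.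

The topological input is that the spliced curves are locally flat (`exists_isFlatChart`), which
gives a separating curve two global sides (`exists_isSeparation`). -/

namespace TwistedLink

/-! ### Locally flat curves and the two sides of a separating curve -/

section Sides

variable {F : Type*} [TopologicalSpace F]

/-- A set which is locally flat at a point stays so if it is changed away from that point. -/
theorem IsFlatChart.exists_of_eventually_iff {S S' : Set F} {x : F} {e : ℝ × ℝ → F}
    (h : IsFlatChart S x e) (hS : ∀ᶠ y in 𝓝 x, y ∈ S ↔ y ∈ S') :
    ∃ e', IsFlatChart S' x e' := by
  obtain ⟨he, hx, hL⟩ := h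
  have h1 : ∀ᶠ p in 𝓝 ((0, 0) : ℝ × ℝ), e p ∈ S ↔ e p ∈ S' :=
    he.continuous.continuousAt.eventually (hx ▸ hS)
  obtain ⟨δ, hδ, hb⟩ := Metric.eventually_nhds_iff_ball.1 h1
  -- Charts are modelled on the whole plane, so restricting to a small square means precomposing
  -- with a homeomorphism of the line onto `(-δ, δ)` fixing 0.
  set φ := OpenPartialHomeomorph.univBall (0 : ℝ) δ
  have hφ : IsOpenEmbedding φ :=
    φ.isOpenEmbedding (OpenPartialHomeomorph.univBall_source _ _)
  have hφ0 : φ 0 = 0 := OpenPartialHomeomorph.univBall_apply_zero _ _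
  have hφb : ∀ t, φ t ∈ Metric.ball (0 : ℝ) δ := fun t => by
    rw [← OpenPartialHomeomorph.univBall_target (0 : ℝ) hδ]
    exact φ.map_source (by simp [φ])
  refine ⟨e ∘ Prod.map φ φ, he.comp (hφ.prodMap hφ), by simp [hφ0, hx], ?_⟩
  ext ⟨u, v⟩
  have h2 : (φ u, φ v) ∈ Metric.ball ((0, 0) : ℝ × ℝ) δ := by
    rw [← ball_prod_same]; exact ⟨hφb u, hφb v⟩
  have h3 : e (φ u, φ v) ∈ S ↔ φ v = 0 := by
    have := Set.ext_iff.1 hL (φ u, φ v)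
    simpa using this
  have h4 : φ v = 0 ↔ v = 0 := by
    exact ⟨fun h => hφ.injective (h.trans hφ0.symm), fun h => h ▸ hφ0⟩
  simp only [mem_preimage, Function.comp, Prod.map, mem_ofPred_eq]
  rw [← hb _ h2, h3, h4]

theorem isPreconnected_upperHalf : IsPreconnected {p : ℝ × ℝ | 0 < p.2} :=
  Convex.isPreconnected (convex_halfSpace_gt (IsLinearMap.mk (fun _ _ => rfl) fun _ _ => rfl) 0)

theorem isPreconnected_lowerHalf : IsPreconnected {p : ℝ × ℝ | p.2 < 0} :=
  Convex.isPreconnected (convex_halfSpace_lt (IsLinearMap.mk (fun _ _ => rfl) fun _ _ => rfl) 0)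

/-- `U` and `V` are two open sets, together the complement of `L`, both of which accumulate at all
points of `L`. -/
structure IsSeparation (L U V : Set F) : Prop where
  isOpen_left : IsOpen U
  isOpen_right : IsOpen V
  disjoint : Disjoint U V
  compl_eq : Lᶜ = U ∪ V
  subset_closure_left : L ⊆ closure U
  subset_closure_right : L ⊆ closure V

theorem subset_left_or_subset_right {L U V A : Set F} (hU : IsOpen U) (hV : IsOpen V)
    (hd : Disjoint U V) (hc : Lᶜ = U ∪ V) (hA : IsPreconnected A) (h : Disjoint A L) :
    A ⊆ U ∨ A ⊆ V :=
  hA.subset_or_subset hU hV hd (hc ▸ h.subset_compl_right)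

theorem IsFlatChart.halves {L U V : Set F} {x : F} {e : ℝ × ℝ → F} (he : IsFlatChart L x e)
    (hU : IsOpen U) (hV : IsOpen V) (hd : Disjoint U V) (hc : Lᶜ = U ∪ V) :
    ({p | 0 < p.2} ⊆ e ⁻¹' U ∨ {p | 0 < p.2} ⊆ e ⁻¹' V) ∧
      ({p | p.2 < 0} ⊆ e ⁻¹' U ∨ {p | p.2 < 0} ⊆ e ⁻¹' V) := by
  have hc' : (e ⁻¹' L)ᶜ = e ⁻¹' U ∪ e ⁻¹' V := by rw [← preimage_compl, hc, preimage_union]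
  have hcont := he.1.continuous
  refine ⟨subset_left_or_subset_right (hU.preimage hcont) (hV.preimage hcont) (hd.preimage e) hc'
      isPreconnected_upperHalf ?_,
    subset_left_or_subset_right (hU.preimage hcont) (hV.preimage hcont) (hd.preimage e) hc'
      isPreconnected_lowerHalf ?_⟩ <;>
  · rw [he.2.2, Set.disjoint_left]
    intro p hp hp'
    simp only [mem_ofPred_eq] at hp hp'
    linarith

/-- The points of a locally flat curve at which a complementary open set accumulates form an open
set. -/
theorem IsFlatChart.eventually_mem_closure {L U V : Set F} {x : F} {e : ℝ × ℝ → F}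
    (he : IsFlatChart L x e) (hU : IsOpen U) (hV : IsOpen V) (hd : Disjoint U V)
    (hc : Lᶜ = U ∪ V) (hx : x ∈ closure U) : ∀ᶠ y in 𝓝 x, y ∈ L → y ∈ closure U := by
  have hr : range e ∈ 𝓝 x := he.1.isOpen_range.mem_nhds ⟨_, he.2.1⟩
  have key : ∀ s : Set (ℝ × ℝ), s ⊆ e ⁻¹' U → {p : ℝ × ℝ | p.2 = 0} ⊆ closure s →
      ∀ᶠ y in 𝓝 x, y ∈ L → y ∈ closure U := by
    intro s hs hs'
    filter_upwards [hr]
    rintro _ ⟨p, rfl⟩ hp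
    have hp' : p ∈ e ⁻¹' L := hp
    rw [he.2.2] at hp'
    exact closure_mono (image_subset_iff.2 hs)
      (image_closure_subset_closure_image he.1.continuous (mem_image_of_mem e (hs' hp')))
  have up : {p : ℝ × ℝ | p.2 = 0} ⊆ closure {p : ℝ × ℝ | 0 < p.2} := by
    rintro ⟨u, v⟩ (rfl : v = 0)
    have h1 : {p : ℝ × ℝ | 0 < p.2} = univ ×ˢ Ioi 0 := by ext; simp
    rw [h1, closure_prod_eq, closure_Ioi]
    simp
  have low : {p : ℝ × ℝ | p.2 = 0} ⊆ closure {p : ℝ × ℝ | p.2 < 0} := by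
    rintro ⟨u, v⟩ (rfl : v = 0)
    have h1 : {p : ℝ × ℝ | p.2 < 0} = univ ×ˢ Iio 0 := by ext; simp
    rw [h1, closure_prod_eq, closure_Iio]
    simp
  obtain ⟨h1, h2⟩ := he.halves hU hV hd hc
  rcases h1 with h1 | h1
  · exact key _ h1 up
  rcases h2 with h2 | h2
  · exact key _ h2 low
  -- With both half-planes in `V`, a point of `U` in the chart would have to lie on the axis, that
  -- is, on `L`.
  exfalso
  obtain ⟨_, ⟨p, rfl⟩, hpU⟩ := mem_closure_iff_nhds.1 hx _ hr
  have hpL : e p ∉ L := fun h => (hc ▸ (Or.inl hpU : e p ∈ U ∪ V) : e p ∈ Lᶜ) h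
  have hp0 : p.2 ≠ 0 := fun h => hpL (by
    have : p ∈ e ⁻¹' L := by rw [he.2.2]; exact h
    exact this)
  rcases lt_or_gt_of_ne hp0 with h | h
  · exact Set.disjoint_left.1 hd hpU (h2 h)
  · exact Set.disjoint_left.1 hd hpU (h1 h)

/-- If an open set in the complement of a connected locally flat curve does not accumulate at the
whole curve, then it is closed. -/
theorem subset_closure_or_isClopen {L U V : Set F} (hL : IsPreconnected L)
    (hflat : ∀ x ∈ L, ∃ e, IsFlatChart L x e) (hU : IsOpen U) (hV : IsOpen V)
    (hd : Disjoint U V) (hc : Lᶜ = U ∪ V) : L ⊆ closure U ∨ IsClopen U := by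
  by_cases hne : (L ∩ closure U).Nonempty
  · left
    -- By flatness `L ∩ closure U` is relatively open in `L`; it is also relatively closed, so
    -- connectedness of `L` makes it everything.
    have hop : IsOpen {x | ∀ᶠ y in 𝓝 x, y ∈ L → y ∈ closure U} := isOpen_setOfPred_eventually_nhds
    by_contra hn
    obtain ⟨y, hyL, hy⟩ := not_subset.1 hn
    obtain ⟨x, hxL, hx⟩ := hne
    have hflat' : ∀ z ∈ L, z ∈ closure U → ∀ᶠ y in 𝓝 z, y ∈ L → y ∈ closure U := by
      intro z hz hzU
      obtain ⟨e, he⟩ := hflat z hz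
      exact he.eventually_mem_closure hU hV hd hc hzU
    have hcov : L ⊆ {x | ∀ᶠ y in 𝓝 x, y ∈ L → y ∈ closure U} ∪ (closure U)ᶜ := fun z hz =>
      (em (z ∈ closure U)).imp (hflat' z hz) id
    obtain ⟨z, hzL, hz1, hz2⟩ := hL _ _ hop isClosed_closure.isOpen_compl hcov
      ⟨x, hxL, hflat' x hxL hx⟩ ⟨y, hyL, hy⟩
    exact hz2 (Eventually.self_of_nhds hz1 hzL)
  · right
    refine ⟨isClosed_of_closure_subset fun x hx => ?_, hU⟩
    by_contra hxU
    have hxL : x ∉ L := fun h => hne ⟨x, h, hx⟩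
    have hxV : x ∈ V := ((hc ▸ hxL : x ∈ U ∪ V)).resolve_left hxU
    exact (hd.closure_left hV).le_bot ⟨hx, hxV⟩

/-- A separating locally flat closed curve has two sides globally. -/
theorem exists_isSeparation [LocallyConnectedSpace F] {L : Set F} (hL : IsConnected L)
    (hLc : IsClosed L) (hflat : ∀ x ∈ L, ∃ e, IsFlatChart L x e) (h : ¬ IsNonSeparating L) :
    ∃ U V, IsSeparation L U V := by
  simp only [IsNonSeparating, not_forall] at h
  obtain ⟨x, hx, hconn⟩ := h
  set C := connectedComponent x
  have hCo : IsOpen C := isOpen_connectedComponent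
  have hCc : IsClosed C := isClosed_connectedComponent
  have hne : (C \ L).Nonempty := by
    obtain ⟨e, he⟩ := hflat x hx
    refine ⟨e (0, 1), ?_, fun hL' => ?_⟩
    · refine (isPreconnected_range he.1.continuous).subset_connectedComponent ⟨(0, 0), he.2.1⟩ ?_
      exact mem_range_self _
    · have : ((0, 1) : ℝ × ℝ) ∈ e ⁻¹' L := hL'
      rw [he.2.2] at this
      exact one_ne_zero this
  have hpre : ¬ IsPreconnected (C \ L) := fun h => hconn ⟨hne, h⟩
  simp only [IsPreconnected, not_forall] at hpre
  obtain ⟨u, v, hu, hv, huv, ⟨a, haC, hau⟩, ⟨b, hbC, hbv⟩, hdisj⟩ := hpre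
  have hCL : IsOpen (C \ L) := hCo.sdiff hLc
  set U := (C \ L) ∩ u
  -- The other components of the surface are put into `V`, so that `U` and `V` exhaust the
  -- complement of `L`.
  set V := ((C \ L) ∩ v) ∪ Cᶜ
  have hU : IsOpen U := hCL.inter hu
  have hV : IsOpen V := (hCL.inter hv).union hCc.isOpen_compl
  have hd : Disjoint U V := by
    rw [Set.disjoint_left]
    rintro y ⟨hy, hyu⟩ (⟨-, hyv⟩ | hy')
    · exact hdisj ⟨y, hy, hyu, hyv⟩
    · exact hy' hy.1
  have hLC : L ⊆ C := hL.isPreconnected.subset_connectedComponent hx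
  have hc : Lᶜ = U ∪ V := by
    ext y
    constructor
    · intro hy
      by_cases hyC : y ∈ C
      · rcases huv ⟨hyC, hy⟩ with h | h
        · exact Or.inl ⟨⟨hyC, hy⟩, h⟩
        · exact Or.inr (Or.inl ⟨⟨hyC, hy⟩, h⟩)
      · exact Or.inr (Or.inr hyC)
    · rintro (h | h | h)
      · exact h.1.2
      · exact h.1.2
      · exact fun h' => h (hLC h')
  have hc' : Lᶜ = V ∪ U := by rw [hc, union_comm]
  have hCp : IsPreconnected C := isPreconnected_connectedComponent
  refine ⟨U, V, hU, hV, hd, hc, ?_, ?_⟩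
  -- A clopen `U` meeting the component `C` would contain all of it, including the point `b` of `V`.
  · refine (subset_closure_or_isClopen hL.isPreconnected hflat hU hV hd hc).resolve_right
      fun hcl => ?_
    have := hCp.subset_isClopen hcl ⟨a, haC.1, haC, hau⟩
    exact Set.disjoint_left.1 hd (this hbC.1) (Or.inl ⟨hbC, hbv⟩)
  · refine (subset_closure_or_isClopen hL.isPreconnected hflat hV hU hd.symm hc').resolve_right
      fun hcl => ?_
    have := hCp.subset_isClopen hcl ⟨b, hbC.1, Or.inl ⟨hbC, hbv⟩⟩
    exact Set.disjoint_left.1 hd ⟨haC, hau⟩ (this haC.1)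

namespace IsSeparation

variable {L U V : Set F}

protected theorem symm (h : IsSeparation L U V) : IsSeparation L V U :=
  ⟨h.isOpen_right, h.isOpen_left, h.disjoint.symm, by rw [h.compl_eq, union_comm],
    h.subset_closure_right, h.subset_closure_left⟩

/-- Each open half-plane is connected, hence lies in one of the two sets; they cannot both lie in
the same one, since `U` and `V` both accumulate at the centre of the chart. -/
theorem preimage_chart (h : IsSeparation L U V) {x : F} {e : ℝ × ℝ → F} (he : IsFlatChart L x e) :
    (e ⁻¹' U = {p | 0 < p.2} ∧ e ⁻¹' V = {p | p.2 < 0}) ∨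
      (e ⁻¹' V = {p | 0 < p.2} ∧ e ⁻¹' U = {p | p.2 < 0}) := by
  have hx : x ∈ L := by
    have : ((0, 0) : ℝ × ℝ) ∈ e ⁻¹' L := by rw [he.2.2]; rfl
    rwa [mem_preimage, he.2.1] at this
  have hr : range e ∈ 𝓝 x := he.1.isOpen_range.mem_nhds ⟨_, he.2.1⟩
  have tri : ∀ p, p ∈ e ⁻¹' U ∨ p ∈ e ⁻¹' V ↔ p.2 ≠ 0 := fun p => by
    have h1 : p ∈ (e ⁻¹' L)ᶜ ↔ p.2 ≠ 0 := by rw [he.2.2]; rfl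
    rw [← h1, ← preimage_compl, h.compl_eq]; rfl
  have hdj : ∀ p, p ∈ e ⁻¹' U → p ∉ e ⁻¹' V := fun p hp hp' =>
    Set.disjoint_left.1 h.disjoint hp hp'
  obtain ⟨_, ⟨p, rfl⟩, hp⟩ := mem_closure_iff_nhds.1 (h.subset_closure_left hx) _ hr
  obtain ⟨_, ⟨q, rfl⟩, hq⟩ := mem_closure_iff_nhds.1 (h.subset_closure_right hx) _ hr
  have hp0 := (tri p).1 (Or.inl hp)
  have hq0 := (tri q).1 (Or.inr hq)
  obtain ⟨h1 | h1, h2 | h2⟩ := he.halves h.isOpen_left h.isOpen_right h.disjoint h.compl_eq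
  · exact absurd hq (hdj q (hq0.lt_or_gt.elim (fun h => h2 h) fun h => h1 h))
  · left
    constructor <;> ext r
    · refine ⟨fun hr => ((tri r).1 (Or.inl hr)).lt_or_gt.resolve_left fun h => ?_, fun h => h1 h⟩
      exact hdj r hr (h2 h)
    · refine ⟨fun hr => ((tri r).1 (Or.inr hr)).lt_or_gt.resolve_right fun h => ?_, fun h => h2 h⟩
      exact hdj r (h1 h) hr
  · right
    constructor <;> ext r
    · refine ⟨fun hr => ((tri r).1 (Or.inr hr)).lt_or_gt.resolve_left fun h => ?_, fun h => h1 h⟩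
      exact hdj r (h2 h) hr
    · refine ⟨fun hr => ((tri r).1 (Or.inl hr)).lt_or_gt.resolve_right fun h => ?_, fun h => h2 h⟩
      exact hdj r hr (h1 h)
  · exact absurd (hp0.lt_or_gt.elim (fun h => h2 h) fun h => h1 h) (hdj p hp)

theorem isSideAt (h : IsSeparation L U V) {x : F} {e : ℝ × ℝ → F} (he : IsFlatChart L x e) :
    IsSideAt L U x := by
  rcases h.preimage_chart he with ⟨h1, -⟩ | ⟨-, h1⟩
  · exact ⟨e, he, h1⟩
  · have hneg : IsOpenEmbedding (Prod.map id Neg.neg : ℝ × ℝ → ℝ × ℝ) :=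
      IsOpenEmbedding.id.prodMap (Homeomorph.neg ℝ).isOpenEmbedding
    refine ⟨e ∘ Prod.map id Neg.neg, ⟨he.1.comp hneg, by simp [he.2.1], ?_⟩, ?_⟩
    · rw [preimage_comp, he.2.2]; ext p; simp
    · rw [preimage_comp, h1]; ext p; simp

theorem eventually_left_or_right (h : IsSeparation L U V) {W : Set F} {x : F}
    (hW : IsSideAt L W x) :
    (∀ᶠ y in 𝓝 x, y ∈ W ↔ y ∈ U) ∨ (∀ᶠ y in 𝓝 x, y ∈ W ↔ y ∈ V) := by
  obtain ⟨e, he, heW⟩ := hW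
  have hr : range e ∈ 𝓝 x := he.1.isOpen_range.mem_nhds ⟨_, he.2.1⟩
  have key : ∀ A : Set F, e ⁻¹' A = {p | 0 < p.2} → ∀ᶠ y in 𝓝 x, y ∈ W ↔ y ∈ A := by
    intro A hA
    filter_upwards [hr]
    rintro _ ⟨p, rfl⟩
    exact Set.ext_iff.1 (heW.trans hA.symm) p
  rcases h.preimage_chart he with ⟨h1, -⟩ | ⟨h1, -⟩
  · exact Or.inl (key _ h1)
  · exact Or.inr (key _ h1)

theorem not_eventually_left_right (h : IsSeparation L U V) {W : Set F} {x : F} (hx : x ∈ L)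
    (hU : ∀ᶠ y in 𝓝 x, y ∈ W ↔ y ∈ U) (hV : ∀ᶠ y in 𝓝 x, y ∈ W ↔ y ∈ V) : False := by
  obtain ⟨y, ⟨h1, h2⟩, hy⟩ := mem_closure_iff_nhds.1 (h.subset_closure_left hx) _ (hU.and hV)
  exact Set.disjoint_left.1 h.disjoint hy (h2.1 (h1.2 hy))

end IsSeparation

end Sides

/-! ### Cyclic succession in a finite subset of the circle -/

section Circle

/-- The length of the arc from `p` forwards to `q`, the whole circle if `p = q`. -/
noncomputable def arcLength (p q : UnitAddCircle) : ℝ := AddCircle.equivIoc (1 : ℝ) 0 (q - p)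

theorem arcLength_pos (p q : UnitAddCircle) : 0 < arcLength p q :=
  (AddCircle.equivIoc (1 : ℝ) 0 (q - p)).2.1

theorem arcLength_le_one (p q : UnitAddCircle) : arcLength p q ≤ 1 :=
  ((AddCircle.equivIoc (1 : ℝ) 0 (q - p)).2.2).trans_eq (zero_add 1)

theorem add_arcLength (p q : UnitAddCircle) : p + (arcLength p q : UnitAddCircle) = q := by
  have : ((arcLength p q : ℝ) : UnitAddCircle) = q - p := AddCircle.coe_equivIoc
  rw [this]; abel

theorem arcLength_add {d : ℝ} (h0 : 0 < d) (h1 : d ≤ 1) (p : UnitAddCircle) :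
    arcLength p (p + (d : UnitAddCircle)) = d := by
  rw [arcLength, add_sub_cancel_left, AddCircle.equivIoc_coe_eq ⟨h0, by simpa using h1⟩]

/-- Going forwards from the point `p` of `P`, the point `q` is the first one of `P` met. -/
def IsNext (P : Finset UnitAddCircle) (p q : UnitAddCircle) : Prop :=
  p ∈ P ∧ q ∈ P ∧ ∃ d : ℝ, 0 < d ∧ d ≤ 1 ∧ q = p + (d : UnitAddCircle) ∧
    ∀ r : ℝ, 0 < r → r < d → p + (r : UnitAddCircle) ∉ P

/-- The successor minimizes `arcLength`. Since `arcLength p p = 1`, a lone point is its own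
successor. -/
theorem exists_isNext {P : Finset UnitAddCircle} {p : UnitAddCircle} (hp : p ∈ P) :
    ∃ q, IsNext P p q := by
  obtain ⟨q, hq, hmin⟩ := P.exists_min_image (arcLength p) ⟨p, hp⟩
  refine ⟨q, hp, hq, arcLength p q, arcLength_pos p q, arcLength_le_one p q,
    (add_arcLength p q).symm, fun r h0 hr hrP => ?_⟩
  have := hmin _ hrP
  rw [arcLength_add h0 (hr.le.trans (arcLength_le_one p q))] at this
  linarith

/-- Of two distinct predecessors, the nearer one would lie inside the arc from the farther one. -/
theorem IsNext.left_unique {P : Finset UnitAddCircle} {p p' q : UnitAddCircle}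
    (h : IsNext P p q) (h' : IsNext P p' q) : p = p' := by
  have key : ∀ {p p' q : UnitAddCircle} {d d' : ℝ}, p ∈ P → q = p + (d : UnitAddCircle) →
      q = p' + (d' : UnitAddCircle) → 0 < d → d < d' →
      (∀ r : ℝ, 0 < r → r < d' → p' + (r : UnitAddCircle) ∉ P) → False := by
    intro p p' q d d' hp hq hq' h0 hd hn
    refine hn (d' - d) (by linarith) (by linarith) ?_
    have : p' + ((d' - d : ℝ) : UnitAddCircle) = p := by
      rw [AddCircle.coe_sub, ← add_sub_assoc, ← hq', hq, add_sub_cancel_right]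
    rwa [this]
  obtain ⟨hp, -, d, h0, -, hq, hn⟩ := h
  obtain ⟨hp', -, d', h0', -, hq', hn'⟩ := h'
  rcases lt_trichotomy d d' with hd | rfl | hd
  · exact (key hp hq hq' h0 hd hn').elim
  · exact add_right_cancel (hq.symm.trans hq')
  · exact (key hp' hq' hq h0' hd hn).elim

/-- Among pairs with `Q` at the start and not at the end, one of least arc length is consecutive: a
point in between, whether or not it satisfies `Q`, would give a shorter pair. This serves as
induction around the circle. -/
theorem exists_isNext_of_mem_of_notMem {P : Finset UnitAddCircle} {Q : UnitAddCircle → Prop}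
    {a b : UnitAddCircle} (ha : a ∈ P) (haQ : Q a) (hb : b ∈ P) (hbQ : ¬ Q b) :
    ∃ p q, IsNext P p q ∧ Q p ∧ ¬ Q q := by
  classical
  obtain ⟨⟨p, q⟩, hpq, hmin⟩ := ((P ×ˢ P).filter fun x => Q x.1 ∧ ¬ Q x.2).exists_min_image
    (fun x => arcLength x.1 x.2) ⟨(a, b), by simp [ha, haQ, hb, hbQ]⟩
  simp only [Finset.mem_filter, Finset.mem_product, and_imp, Prod.forall] at hpq hmin
  obtain ⟨⟨hp, hq⟩, hpQ, hqQ⟩ := hpq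
  have h1 := arcLength_le_one p q
  refine ⟨p, q, ⟨hp, hq, arcLength p q, arcLength_pos p q, h1,
    (add_arcLength p q).symm, fun r h0 hr hrP => ?_⟩, hpQ, hqQ⟩
  by_cases hrQ : Q (p + (r : UnitAddCircle))
  · have h2 := hmin _ _ hrP hq hrQ hqQ
    have h3 : q = p + (r : UnitAddCircle) + ((arcLength p q - r : ℝ) : UnitAddCircle) := by
      rw [AddCircle.coe_sub, add_assoc, add_sub_cancel, add_arcLength]
    have h4 : arcLength (p + (r : UnitAddCircle)) q = arcLength p q - r := by
      conv_lhs => rw [h3]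
      exact arcLength_add (by linarith) (by linarith) _
    linarith
  · have h2 := hmin _ _ hp hrP hpQ hrQ
    rw [arcLength_add h0 (by linarith)] at h2
    linarith

end Circle

/-! ### Alternation of poles, and the excess under pole reductions -/

/-- The sign of a pole. -/
def PoleKind.sign : PoleKind → ℤ
  | PoleKind.sink => 1
  | PoleKind.source => -1

theorem PoleKind.sign_add_sign {a b : PoleKind} (h : a ≠ b) :
    PoleKind.sign a + PoleKind.sign b = 0 := by
  cases a <;> cases b <;> simp_all [PoleKind.sign]

namespace PoleCurve

variable {F : Type*} [TopologicalSpace F]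

/-- The orientation is constant on the pole-free arc, whereas two sinks, or two sources, would
require opposite orientations at its ends. The case `p = q` is included, so a curve never has
exactly one pole. -/
theorem kind_ne_of_isNext (l : PoleCurve F) {p q : UnitAddCircle} (h : IsNext l.poles p q) :
    l.kind p ≠ l.kind q := by
  obtain ⟨hp, hq, d, h0, -, rfl, hn⟩ := h
  -- Local constancy is read as continuity into the discrete space `Bool`.
  have hcont : ContinuousOn (fun r : ℝ => l.dir (p + (r : UnitAddCircle))) (Ioo 0 d) := by
    intro r hr
    refine ContinuousAt.continuousWithinAt (Filter.EventuallyEq.continuousAt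
      (y := l.dir (p + (r : UnitAddCircle))) ?_)
    have h1 := l.dir_of_notMem _ (hn r hr.1 hr.2)
    have h2 : Tendsto (fun s : ℝ => s - r) (𝓝 r) (𝓝 0) := by
      have : ContinuousAt (fun s : ℝ => s - r) r := by fun_prop
      simpa [ContinuousAt] using this
    filter_upwards [h2.eventually h1] with s hs
    rw [← hs, add_assoc, ← AddCircle.coe_add, add_sub_cancel]
  have hconst : ∀ r ∈ Ioo 0 d, ∀ s ∈ Ioo 0 d,
      l.dir (p + (r : UnitAddCircle)) = l.dir (p + (s : UnitAddCircle)) :=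
    fun r hr s hs => isPreconnected_Ioo.constant hcont hr hs
  have hsmall : ∀ᶠ ε : ℝ in 𝓝[>] 0, ε ∈ Ioo 0 d := Ioo_mem_nhdsGT h0
  have hback : ∀ ε : ℝ, p + (d : UnitAddCircle) - (ε : UnitAddCircle) =
      p + ((d - ε : ℝ) : UnitAddCircle) := fun ε => by
    rw [AddCircle.coe_sub, add_sub_assoc]
  intro hk
  cases hkp : l.kind p with
  | sink =>
    obtain ⟨ε, ⟨h1, h2⟩, hε⟩ := (((l.dir_of_sink _ hp hkp).and
      (l.dir_of_sink _ hq (hk ▸ hkp))).and hsmall).exists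
    have := hconst ε hε (d - ε) ⟨by linarith [hε.2], by linarith [hε.1]⟩
    rw [h1.2, ← hback, h2.1] at this
    simp at this
  | source =>
    obtain ⟨ε, ⟨h1, h2⟩, hε⟩ := (((l.dir_of_source _ hp hkp).and
      (l.dir_of_source _ hq (hk ▸ hkp))).and hsmall).exists
    have := hconst ε hε (d - ε) ⟨by linarith [hε.2], by linarith [hε.1]⟩
    rw [h1.2, ← hback, h2.1] at this
    simp at this

open Classical in
-- The successor map sends poles of one kind to poles of the other, and it is injective.
theorem card_filter_le (l : PoleCurve F) {a b : PoleKind} (hab : ∀ c, c ≠ a → c = b) :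
    (l.poles.filter fun t => l.kind t = a).card ≤ (l.poles.filter fun t => l.kind t = b).card := by
  have h : ∀ p : UnitAddCircle, ∃ q, p ∈ l.poles → IsNext l.poles p q := fun p => by
    by_cases hp : p ∈ l.poles
    · exact (exists_isNext hp).imp fun _ h _ => h
    · exact ⟨p, fun h => absurd h hp⟩
  choose f hf using h
  refine Finset.card_le_card_of_injOn f (fun p hp => ?_) fun p hp p' hp' hpp => ?_
  · simp only [Finset.coe_filter, mem_ofPred_eq] at hp
    have h1 := hf p hp.1
    simp only [Finset.coe_filter, mem_ofPred_eq]
    exact ⟨h1.2.1, hab _ fun h => l.kind_ne_of_isNext h1 (hp.2.trans h.symm)⟩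
  · simp only [Finset.coe_filter, mem_ofPred_eq] at hp hp'
    exact (hf p hp.1).left_unique (hpp ▸ hf p' hp'.1)

/-- On every pole curve there are as many sink poles as source poles. -/
theorem sum_sign_eq_zero (l : PoleCurve F) : ∑ t ∈ l.poles, PoleKind.sign (l.kind t) = 0 := by
  classical
  have h1 := l.card_filter_le (a := .sink) (b := .source) (by rintro (_ | _) <;> simp)
  have h2 := l.card_filter_le (a := .source) (b := .sink) (by rintro (_ | _) <;> simp)
  have h3 : ∀ t, PoleKind.sign (l.kind t) =
      (if l.kind t = .sink then 1 else 0) - (if l.kind t = .source then 1 else 0) := by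
    intro t; cases l.kind t <;> simp [PoleKind.sign]
  simp only [h3, Finset.sum_sub_distrib, Finset.sum_boole]
  rw [le_antisymm h1 h2, sub_self]

/-- The pole at `t` lies on the side `U`. -/
def PoleOn (l : PoleCurve F) (U : Set F) (t : UnitAddCircle) : Prop :=
  ∀ᶠ y in 𝓝 (l.toFun t), y ∈ l.side t ↔ y ∈ U

open Classical in
/-- The number of sink poles on the side `U`, minus the number of source poles there. -/
noncomputable def excess (l : PoleCurve F) (U : Set F) : ℤ :=
  ∑ t ∈ l.poles, if l.PoleOn U t then PoleKind.sign (l.kind t) else 0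

theorem poleOn_or (l : PoleCurve F) {U V : Set F} (h : IsSeparation l.carrier U V)
    {t : UnitAddCircle} (ht : t ∈ l.poles) : l.PoleOn U t ∨ l.PoleOn V t :=
  h.eventually_left_or_right (l.isSideAt_side t ht)

theorem not_poleOn_both (l : PoleCurve F) {U V : Set F} (h : IsSeparation l.carrier U V)
    {t : UnitAddCircle} (hU : l.PoleOn U t) (hV : l.PoleOn V t) : False :=
  h.not_eventually_left_right (mem_range_self t) hU hV

/-- The poles of a reducible pair lie on the same side of a separating curve. -/
theorem IsReduciblePair.poleOn {l : PoleCurve F} {U V : Set F}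
    (h : IsSeparation l.carrier U V) {p q : UnitAddCircle} (hpq : l.IsReduciblePair p q)
    (hp : l.PoleOn U p) : l.PoleOn U q := by
  obtain ⟨hpP, hqP, -, d, h0, -, rfl, -, W, hW, hWp, hWq⟩ := hpq
  set g : ℝ → F := fun r => l.toFun (p + (r : UnitAddCircle))
  have hg : Continuous g := l.continuous_toFun.comp
    (continuous_const.add (AddCircle.continuous_mk' (1 : ℝ)))
  have hop : ∀ A : Set F, IsOpen {r | ∀ᶠ y in 𝓝 (g r), y ∈ W ↔ y ∈ A} := fun A =>
    (isOpen_setOfPred_eventually_nhds (p := fun y => y ∈ W ↔ y ∈ A)).preimage hg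
  -- The side `W` followed along the arc agrees locally with exactly one of `U`, `V`. Both
  -- conditions are open, so connectedness of the interval prevents a switch.
  have hsub : Icc 0 d ⊆ {r | ∀ᶠ y in 𝓝 (g r), y ∈ W ↔ y ∈ U} := by
    refine isPreconnected_Icc.subset_left_of_subset_union (hop U) (hop V) ?_
      (fun r hr => h.eventually_left_or_right (hW r hr.1 hr.2))
      ⟨0, left_mem_Icc.2 h0.le, ?_⟩
    · rw [Set.disjoint_left]
      exact fun r hU hV => h.not_eventually_left_right (mem_range_self _) hU hV
    · have : g 0 = l.toFun p := by simp [g]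
      simp only [mem_ofPred_eq, this]
      filter_upwards [hWp, hp] with y h1 h2 using h1.trans h2
  have := hsub (right_mem_Icc.2 h0.le)
  filter_upwards [hWq, this] with y h1 h2 using h1.symm.trans h2

/-- The two removed poles are both counted, with opposite signs, or both not counted. -/
theorem Reduces.excess_eq {l l' : PoleCurve F} {U V : Set F} (h : IsSeparation l.carrier U V)
    (hl : l.Reduces l') : l'.excess U = l.excess U := by
  classical
  obtain ⟨p, q, hpq, hf, hP, hk⟩ := hl
  have hpqne : p ≠ q := fun h => hpq.2.2.1 (by rw [h])
  have hP' : l'.poles = (l.poles.erase p).erase q := by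
    ext t; rw [hP, Finset.mem_erase, Finset.mem_erase]; tauto
  have hiff : l.PoleOn U p ↔ l.PoleOn U q := by
    refine ⟨hpq.poleOn h, fun hq => (l.poleOn_or h hpq.1).resolve_right fun hp => ?_⟩
    exact l.not_poleOn_both h hq (hpq.poleOn h.symm hp)
  have h1 : l'.excess U = ∑ t ∈ l'.poles, if l.PoleOn U t then PoleKind.sign (l.kind t) else 0 := by
    refine Finset.sum_congr rfl fun t ht => ?_
    obtain ⟨h1, h2⟩ := hk t ht
    have h3 : l'.PoleOn U t ↔ l.PoleOn U t := by
      unfold PoleOn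
      rw [hf]
      exact eventually_congr (h2.mono fun y hy => by rw [hy])
    simp only [h1, h3]
  rw [h1, hP', excess, ← Finset.add_sum_erase _ _ hpq.1,
    ← Finset.add_sum_erase _ _ (Finset.mem_erase.2 ⟨hpqne.symm, hpq.2.1⟩), ← add_assoc]
  have h2 := PoleKind.sign_add_sign hpq.2.2.1
  by_cases hU : l.PoleOn U p
  · simp [hU, hiff.1 hU, h2]
  · simp [hU, mt hiff.2 hU]

theorem reflTransGen_excess_eq {l l' : PoleCurve F} {U V : Set F}
    (h : IsSeparation l.carrier U V) (hl : Relation.ReflTransGen Reduces l l') :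
    l'.toFun = l.toFun ∧ l'.excess U = l.excess U := by
  induction hl with
  | refl => exact ⟨rfl, rfl⟩
  | tail _ hr ih =>
    obtain ⟨h1, h2⟩ := ih
    have h3 := hr
    obtain ⟨-, -, -, h4, -⟩ := h3
    exact ⟨h4.trans h1, (hr.excess_eq (by rwa [carrier, h1])).trans h2⟩

/-- On an irreducible separating curve, consecutive poles lie on different sides. -/
theorem IsIrreducible.poleOn_iff_not {l : PoleCurve F} {U V : Set F} (hl : l.IsIrreducible)
    (h : IsSeparation l.carrier U V) (hflat : ∀ x ∈ l.carrier, ∃ e, IsFlatChart l.carrier x e)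
    {p q : UnitAddCircle} (hpq : IsNext l.poles p q) : l.PoleOn U p ↔ ¬ l.PoleOn U q := by
  have hk := l.kind_ne_of_isNext hpq
  obtain ⟨hp, hq, d, h0, h1, hqd, hn⟩ := hpq
  have key : ∀ {A B : Set F}, IsSeparation l.carrier A B → l.PoleOn A p → ¬ l.PoleOn A q := by
    intro A B hAB hpA hqA
    refine hl p q ⟨hp, hq, hk, d, h0, h1.lt_of_ne ?_, hqd, hn, A, fun r _ _ => ?_, ?_, ?_⟩
    -- A full turn would make `q = p`, against the difference of kinds.
    · rintro rfl
      exact hk (by rw [hqd, AddCircle.coe_period, add_zero])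
    · obtain ⟨e, he⟩ := hflat _ (mem_range_self (p + (r : UnitAddCircle)))
      exact hAB.isSideAt he
    · exact hpA.mono fun _ h => h.symm
    · exact hqA.mono fun _ h => h.symm
  refine ⟨key h, fun hqU => (l.poleOn_or h hp).resolve_right fun hpV => ?_⟩
  exact key h.symm hpV ((l.poleOn_or h hq).resolve_left hqU)

/-- From one pole to the next both the side and the kind flip, so whether "on `U`" agrees with
"sink" is the same at all poles. Either all the sinks or all the sources are then on `U`. -/
theorem IsIrreducible.poles_eq_empty {l : PoleCurve F} {U V : Set F} (hl : l.IsIrreducible)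
    (h : IsSeparation l.carrier U V) (hflat : ∀ x ∈ l.carrier, ∃ e, IsFlatChart l.carrier x e)
    (hex : l.excess U = 0) : l.poles = ∅ := by
  classical
  set Q : UnitAddCircle → Prop := fun t => (l.PoleOn U t ↔ l.kind t = .sink) with hQ
  have hnext : ∀ p q, IsNext l.poles p q → (Q p ↔ Q q) := by
    intro p q hpq
    have h1 := hl.poleOn_iff_not h hflat hpq
    have h2 := l.kind_ne_of_isNext hpq
    simp only [hQ]
    cases hp : l.kind p <;> cases hq : l.kind q <;> simp_all
  have hconst : ∀ p ∈ l.poles, ∀ q ∈ l.poles, Q p → Q q := by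
    intro p hp q hq hpQ
    by_contra hqQ
    obtain ⟨a, b, hab, haQ, hbQ⟩ := exists_isNext_of_mem_of_notMem hp hpQ hq hqQ
    exact hbQ ((hnext a b hab).1 haQ)
  have hsum := l.sum_sign_eq_zero
  by_contra hne
  obtain ⟨p, hp⟩ := Finset.nonempty_iff_ne_empty.2 hne
  -- A pole contributes its sign if it is on `U` and minus its sign otherwise, which is 1 or -1
  -- according to `Q`. As `Q` is constant, the sum is plus or minus the number of poles.
  have hdouble : 2 * l.excess U - ∑ t ∈ l.poles, PoleKind.sign (l.kind t) =
      ∑ t ∈ l.poles, if Q t then 1 else -1 := by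
    rw [excess, Finset.mul_sum, ← Finset.sum_sub_distrib]
    refine Finset.sum_congr rfl fun t _ => ?_
    simp only [hQ]
    cases l.kind t <;> by_cases hU : l.PoleOn U t <;> simp [hU, PoleKind.sign]
  rw [hex, hsum] at hdouble
  have hcard := Finset.card_ne_zero_of_mem hp
  by_cases hpQ : Q p
  · rw [Finset.sum_congr rfl fun t ht => if_pos (hconst p hp t ht hpQ)] at hdouble
    rw [Finset.sum_const, nsmul_eq_mul] at hdouble
    omega
  · rw [Finset.sum_congr rfl fun t ht => if_neg fun h => hpQ (hconst t ht p hp h)] at hdouble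
    rw [Finset.sum_const, nsmul_eq_mul] at hdouble
    omega

end PoleCurve

/-! ### Flat charts for the splice arcs in the plane -/

section Sides

variable {F G : Type*} [TopologicalSpace F] [TopologicalSpace G]

theorem IsFlatChart.comp_isOpenEmbedding {S : Set F} {x : F} {e : ℝ × ℝ → F}
    (h : IsFlatChart S x e) {g : F → G} (hg : IsOpenEmbedding g) {T : Set G} (hT : g ⁻¹' T = S) :
    IsFlatChart T (g x) (g ∘ e) :=
  ⟨hg.comp h.1, by simp [h.2.1], by rw [preimage_comp, hT, h.2.2]⟩

/-- The homeomorphism of the plane carrying the horizontal axis to the graph of `f`, where `x + y`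
is the argument (shifted by `b`) and `σ * (x - y)` the value, with `σ = 1` or `σ = -1`. -/
noncomputable def shear (f : ℝ → ℝ) (hf : Continuous f) (σ b : ℝ) (hσ : σ * σ = 1) :
    ℝ × ℝ ≃ₜ ℝ × ℝ where
  toFun p := ((p.1 + b + σ * (f (p.1 + b) + p.2)) / 2, (p.1 + b - σ * (f (p.1 + b) + p.2)) / 2)
  invFun p := (p.1 + p.2 - b, σ * (p.1 - p.2) - f (p.1 + p.2))
  left_inv := by
    rintro ⟨u, v⟩
    have h1 : (u + b + σ * (f (u + b) + v)) / 2 + (u + b - σ * (f (u + b) + v)) / 2 = u + b := by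
      ring
    have h2 : σ * ((u + b + σ * (f (u + b) + v)) / 2 - (u + b - σ * (f (u + b) + v)) / 2) =
        f (u + b) + v := by linear_combination (f (u + b) + v) * hσ
    simp only [h1, h2, Prod.mk.injEq]
    constructor <;> ring
  right_inv := by
    rintro ⟨x, y⟩
    have h1 : x + y - b + b = x + y := by ring
    have h2 : σ * (f (x + y) + (σ * (x - y) - f (x + y))) = x - y := by
      linear_combination (x - y) * hσ
    simp only [h1, h2, Prod.mk.injEq]
    constructor <;> ring
  continuous_toFun := by fun_prop
  continuous_invFun := by fun_prop

/-- In the rotated coordinates `x + y` and `σ * (x - y)` each arc is the graph of `max |t| 1`; the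
sign `σ` selects the arc through `p`. -/
theorem exists_isFlatChart_orientedArcs {p : ℝ × ℝ} (hp : p ∈ orientedArcs) :
    ∃ e, IsFlatChart orientedArcs p e := by
  have hp' : |p.1 - p.2| = max |p.1 + p.2| 1 := hp
  have hpos : 0 < |p.1 - p.2| := hp' ▸ lt_max_of_lt_right one_pos
  obtain ⟨σ, hσ, hσp⟩ : ∃ σ : ℝ, σ * σ = 1 ∧ σ * (p.1 - p.2) = |p.1 - p.2| := by
    rcases abs_choice (p.1 - p.2) with h | h
    · exact ⟨1, by ring, by rw [h, one_mul]⟩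
    · exact ⟨-1, by ring, by rw [h]; ring⟩
  have hf : Continuous fun t : ℝ => max |t| 1 := by fun_prop
  set h := shear _ hf σ (p.1 + p.2) hσ
  have hflat : IsFlatChart {q : ℝ × ℝ | σ * (q.1 - q.2) = max |q.1 + q.2| 1} p h := by
    refine ⟨h.isOpenEmbedding, ?_, ?_⟩
    · rw [← h.eq_symm_apply]
      show _ = (p.1 + p.2 - (p.1 + p.2), σ * (p.1 - p.2) - max |p.1 + p.2| 1)
      rw [hσp, hp', sub_self, sub_self]
    · ext q
      have h1 : (h.symm (h q)).2 = q.2 := by rw [h.symm_apply_apply]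
      have h2 : (h.symm (h q)).2 = σ * ((h q).1 - (h q).2) - max |(h q).1 + (h q).2| 1 := rfl
      simp only [mem_preimage, mem_ofPred_eq]
      rw [← h1, h2, sub_eq_zero]
  refine hflat.exists_of_eventually_iff ?_
  -- Near `p` the sign of `x - y` does not change, so only this arc is present.
  have hcont : Continuous fun q : ℝ × ℝ => σ * (q.1 - q.2) := by fun_prop
  filter_upwards [(isOpen_Ioi.preimage hcont).mem_nhds (show p ∈ _ ⁻¹' Ioi 0 by
    rw [mem_preimage, hσp]; exact hpos)] with q hq
  have hq' : |q.1 - q.2| = σ * (q.1 - q.2) := by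
    have h1 : |σ| = 1 := by
      rw [← abs_one, ← sq_eq_sq_iff_abs_eq_abs]; linarith
    have h2 : |σ * (q.1 - q.2)| = σ * (q.1 - q.2) := abs_of_pos hq
    rw [← h2, abs_mul, h1, one_mul]
  simp only [mem_ofPred_eq, orientedArcs, hq']

/-- Reflection in the horizontal axis exchanges the two kinds of splice arcs. -/
theorem exists_isFlatChart_unorientedArcs {p : ℝ × ℝ} (hp : p ∈ unorientedArcs) :
    ∃ e, IsFlatChart unorientedArcs p e := by
  set r : ℝ × ℝ ≃ₜ ℝ × ℝ := (Homeomorph.refl ℝ).prodCongr (Homeomorph.neg ℝ)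
  have hr : ∀ q, r q = (q.1, -q.2) := fun q => rfl
  have hpre : r ⁻¹' unorientedArcs = orientedArcs := by
    ext q
    simp [hr, unorientedArcs, orientedArcs, sub_eq_add_neg]
  have hrr : r (r p) = p := by simp [hr]
  have h1 : r p ∈ orientedArcs := by rw [← hpre, mem_preimage, hrr]; exact hp
  obtain ⟨e, he⟩ := exists_isFlatChart_orientedArcs h1
  exact ⟨_, hrr ▸ he.comp_isOpenEmbedding r.isOpenEmbedding hpre⟩

end Sides

/-! ### Plane geometry of a splice -/

theorem isCompact_spliceSquare : IsCompact spliceSquare := by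
  refine (isCompact_Icc (a := ((-1, -1) : ℝ × ℝ)) (b := (1, 1))).of_isClosed_subset ?_ ?_
  · have h1 : Continuous fun p : ℝ × ℝ => |p.1 + p.2| := by fun_prop
    have h2 : Continuous fun p : ℝ × ℝ => |p.1 - p.2| := by fun_prop
    exact (isClosed_le h1 continuous_const).inter (isClosed_le h2 continuous_const)
  · rintro ⟨x, y⟩ ⟨h1, h2⟩
    simp only [abs_le] at h1 h2
    exact ⟨⟨by simp only; linarith, by simp only; linarith⟩,
      ⟨by simp only; linarith, by simp only; linarith⟩⟩

theorem abs_eq_max_iff_of_notMem {a b : ℝ} (h : ¬ (|b| ≤ 1 ∧ |a| ≤ 1)) :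
    |a| = max |b| 1 ↔ |a| = |b| := by
  constructor
  · intro hab
    rcases le_total |b| 1 with hb | hb
    · rw [max_eq_right hb] at hab
      exact absurd ⟨hb, hab.le⟩ h
    · rwa [max_eq_left hb] at hab
  · intro hab
    rw [hab, and_self, not_le] at h
    rw [hab, max_eq_left h.le]

theorem abs_sub_eq_abs_add_iff {x y : ℝ} : |x - y| = |x + y| ↔ x = 0 ∨ y = 0 := by
  rw [← sq_eq_sq_iff_abs_eq_abs, ← mul_eq_zero]
  constructor <;> intro h <;> linarith

/-- The region is star-shaped about the crossing. Its connectedness puts both poles of a crossing on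
the same side of a separating curve. -/
theorem isPreconnected_middleRegion : IsPreconnected middleRegion := by
  have : StarConvex ℝ (0 : ℝ × ℝ) middleRegion := by
    rw [starConvex_zero_iff]
    intro p hp t h0 h1
    have hp' : |p.1 + p.2| < max |p.1 - p.2| 1 := hp
    show |t * p.1 + t * p.2| < max |t * p.1 - t * p.2| 1
    rw [← mul_add, ← mul_sub, abs_mul, abs_mul, abs_of_nonneg h0]
    rcases h0.eq_or_lt with rfl | h0
    · simp
    rcases lt_max_iff.1 hp' with h | h
    · exact lt_max_of_lt_left (mul_lt_mul_of_pos_left h h0)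
    · exact lt_max_of_lt_right ((mul_lt_mul_of_pos_left h h0).trans_le (by linarith))
  exact (this.isPathConnected (by simp [middleRegion])).isConnected.isPreconnected

theorem mem_closure_middleRegion {a : ℝ} (ha : |a| = 1 / 2) : (a, a) ∈ closure middleRegion := by
  have hlim : Tendsto (fun t : ℝ => (t * a, t * a)) (𝓝[<] 1) (𝓝 (a, a)) := by
    have : Continuous fun t : ℝ => (t * a, t * a) := by fun_prop
    have h := this.tendsto 1
    simp only [one_mul] at h
    exact h.mono_left nhdsWithin_le_nhds
  refine mem_closure_of_tendsto hlim ?_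
  filter_upwards [Ioo_mem_nhdsLT (zero_lt_one (α := ℝ))] with t ht
  show |t * a + t * a| < max |t * a - t * a| 1
  refine lt_max_of_lt_right ?_
  rw [← two_mul, ← mul_assoc, abs_mul, ha, abs_of_pos (by linarith [ht.1])]
  linarith [ht.2]

theorem PoleCurveLink.eq_of_toFun_eq {F : Type*} [TopologicalSpace F] (s : PoleCurveLink F)
    {i j : Fin s.n} {t u : UnitAddCircle} (h : (s.curve i).toFun t = (s.curve j).toFun u) :
    (⟨i, t⟩ : Σ _ : Fin s.n, UnitAddCircle) = ⟨j, u⟩ := by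
  obtain rfl : i = j := by
    by_contra hij
    exact Set.disjoint_left.1 (s.disjoint i j hij) (mem_range_self t) (h ▸ mem_range_self u)
  rw [(s.curve i).injective_toFun h]

theorem PoleCurve.isCompact_carrier {F : Type*} [TopologicalSpace F] (l : PoleCurve F) :
    IsCompact l.carrier :=
  isCompact_range l.continuous_toFun

theorem PoleCurve.isConnected_carrier {F : Type*} [TopologicalSpace F] (l : PoleCurve F) :
    IsConnected l.carrier :=
  isConnected_range l.continuous_toFun

/-! ### The spliced diagram and its pole points -/

namespace LinkDiagram

variable {F : Type*} [TopologicalSpace F] (D : LinkDiagram F)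

theorem chart_eq {c c' : Fin D.m} {p q : ℝ × ℝ} (h : D.chart c p = D.chart c' q) :
    c = c' ∧ p = q := by
  obtain rfl : c = c' := by
    by_contra hc
    exact Set.disjoint_left.1 (D.disjoint_chart c c' hc) (mem_range_self p)
      (h ▸ mem_range_self q)
  exact ⟨rfl, (D.isOpenEmbedding_chart c).injective h⟩

theorem chart_mem_splicedCarrier {σ : Fin D.m → Splice} {c : Fin D.m} {p : ℝ × ℝ} :
    D.chart c p ∈ D.splicedCarrier σ ↔ p ∈ D.spliceArcs c (σ c) := by
  constructor
  · rintro (⟨-, h⟩ | h)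
    · exact absurd (mem_iUnion.2 ⟨c, mem_range_self p⟩) h
    · obtain ⟨c', q, hq, h⟩ := mem_iUnion.1 h
      obtain ⟨rfl, rfl⟩ := D.chart_eq h
      exact hq
  · exact fun h => Or.inr (mem_iUnion.2 ⟨c, mem_image_of_mem _ h⟩)

/-- Outside the square the constant 1 in the equations of the arcs plays no role; they reduce to `|x
- y| = |x + y|`, the equation of the two axes. -/
theorem mem_splicedCarrier_iff {σ : Fin D.m → Splice} {y : F}
    (hy : ∀ c, y ∉ D.chart c '' spliceSquare) : y ∈ D.carrier ↔ y ∈ D.splicedCarrier σ := by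
  by_cases h : ∃ c, y ∈ range (D.chart c)
  · obtain ⟨c, p, rfl⟩ := h
    have hp : ¬ (|p.1 + p.2| ≤ 1 ∧ |p.1 - p.2| ≤ 1) := fun h => hy c (mem_image_of_mem _ h)
    have h1 : D.chart c p ∈ D.carrier ↔ p.1 = 0 ∨ p.2 = 0 := Set.ext_iff.1 (D.chart_preimage c) p
    rw [h1, chart_mem_splicedCarrier, spliceArcs]
    split_ifs
    · exact ((abs_eq_max_iff_of_notMem hp).trans abs_sub_eq_abs_add_iff).symm
    · refine ((abs_eq_max_iff_of_notMem fun h => hp h.symm).trans ?_).symm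
      rw [eq_comm]
      exact abs_sub_eq_abs_add_iff
  · have h1 : y ∉ ⋃ c, range (D.chart c) := fun h' => h (mem_iUnion.1 h')
    refine ⟨fun hy => Or.inl ⟨hy, h1⟩, ?_⟩
    rintro (h2 | h2)
    · exact h2.1
    · obtain ⟨c, p, -, rfl⟩ := mem_iUnion.1 h2
      exact absurd ⟨c, mem_range_self p⟩ h

/-- Inside a crossing chart the arcs are flat. Elsewhere the flatness of the diagram carries over,
because the splice squares are compact, so their images are closed and a neighbourhood avoids them.
-/
theorem exists_isFlatChart_splicedCarrier [T2Space F] {σ : Fin D.m → Splice} {x : F}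
    (hx : x ∈ D.splicedCarrier σ) : ∃ e, IsFlatChart (D.splicedCarrier σ) x e := by
  by_cases h : ∃ c, x ∈ range (D.chart c)
  · obtain ⟨c, p, rfl⟩ := h
    have hp := D.chart_mem_splicedCarrier.1 hx
    obtain ⟨e, he⟩ : ∃ e, IsFlatChart (D.spliceArcs c (σ c)) p e := by
      unfold spliceArcs at hp ⊢
      split_ifs at hp ⊢
      · exact exists_isFlatChart_orientedArcs hp
      · exact exists_isFlatChart_unorientedArcs hp
    exact ⟨_, he.comp_isOpenEmbedding (D.isOpenEmbedding_chart c)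
      (Set.ext fun _ => D.chart_mem_splicedCarrier)⟩
  · push Not at h
    have hsq : ∀ c, x ∉ D.chart c '' spliceSquare := fun c hc => h c (image_subset_range _ _ hc)
    have hxD := (D.mem_splicedCarrier_iff hsq).2 hx
    obtain ⟨k, t, rfl⟩ := mem_iUnion.1 hxD
    obtain ⟨e, he⟩ := D.flat k t fun c hc => h c (hc ▸ mem_range_self _)
    refine he.exists_of_eventually_iff ?_
    have hev : ∀ᶠ y in 𝓝 (D.comp k t), ∀ c, y ∉ D.chart c '' spliceSquare := by
      rw [eventually_all]
      intro c
      have := isCompact_spliceSquare.image (D.isOpenEmbedding_chart c).continuous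
      exact this.isClosed.isOpen_compl.mem_nhds (hsq c)
    exact hev.mono fun y hy => D.mem_splicedCarrier_iff hy

/-- The point at which a pole of the given kind is created at a crossing. -/
noncomputable def polePoint (c : Fin D.m) : PoleKind → F
  | PoleKind.sink => D.sinkPoint c
  | PoleKind.source => D.sourcePoint c

theorem exists_polePoint_eq_iff {c : Fin D.m} {x : F} :
    (∃ κ, x = D.polePoint c κ) ↔ x = D.sinkPoint c ∨ x = D.sourcePoint c :=
  ⟨by rintro ⟨_ | _, h⟩; exacts [Or.inl h, Or.inr h],
    by rintro (h | h); exacts [⟨.sink, h⟩, ⟨.source, h⟩]⟩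

theorem exists_polePoint (c : Fin D.m) (κ : PoleKind) :
    ∃ p, D.polePoint c κ = D.chart c p ∧ p ∈ closure middleRegion ∧ p ∈ unorientedArcs := by
  cases κ
  · refine ⟨_, rfl, mem_closure_middleRegion (by rw [abs_neg]; norm_num), ?_⟩
    norm_num [unorientedArcs]
  · refine ⟨_, rfl, mem_closure_middleRegion (by norm_num), ?_⟩
    norm_num [unorientedArcs]

theorem polePoint_injective {c c' : Fin D.m} {κ κ' : PoleKind}
    (h : D.polePoint c κ = D.polePoint c' κ') : c = c' ∧ κ = κ' := by
  cases κ <;> cases κ' <;> obtain ⟨h1, h2⟩ := D.chart_eq h <;> refine ⟨h1, ?_⟩ <;>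
    first | rfl | norm_num at h2

theorem polePoint_mem_closure (c : Fin D.m) (κ : PoleKind) :
    D.polePoint c κ ∈ closure (D.chart c '' middleRegion) := by
  obtain ⟨p, hp, hcl, -⟩ := D.exists_polePoint c κ
  rw [hp]
  exact image_closure_subset_closure_image (D.isOpenEmbedding_chart c).continuous
    (mem_image_of_mem _ hcl)

theorem isPreconnected_middle (c : Fin D.m) : IsPreconnected (D.chart c '' middleRegion) :=
  isPreconnected_middleRegion.image _ (D.isOpenEmbedding_chart c).continuous.continuousOn

/-! ### Counting the poles of a state by their middle regions -/

namespace IsSpliceOf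

variable {D} {σ : Fin D.m → Splice} {s : PoleCurveLink F}

/-- The other curves are finitely many disjoint compact sets, so near a point of this curve it is
the whole state. -/
theorem exists_isFlatChart [T2Space F] (h : D.IsSpliceOf σ s) (i : Fin s.n) {x : F}
    (hx : x ∈ (s.curve i).carrier) : ∃ e, IsFlatChart (s.curve i).carrier x e := by
  have hxs : x ∈ s.carrier := mem_iUnion.2 ⟨i, hx⟩
  obtain ⟨e, he⟩ := D.exists_isFlatChart_splicedCarrier (h.carrier_eq ▸ hxs)
  rw [← h.carrier_eq] at he
  refine he.exists_of_eventually_iff ?_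
  have hev : ∀ᶠ y in 𝓝 x, ∀ j, j ≠ i → y ∉ (s.curve j).carrier := by
    simp only [eventually_all]
    intro j hj
    exact (s.curve j).isCompact_carrier.isClosed.isOpen_compl.mem_nhds
      fun hxj => Set.disjoint_left.1 (s.disjoint j i hj) hxj hx
  filter_upwards [hev] with y hy
  refine ⟨fun hys => ?_, fun hyi => mem_iUnion.2 ⟨i, hyi⟩⟩
  obtain ⟨j, hj⟩ := mem_iUnion.1 hys
  by_cases hji : j = i
  · exact hji ▸ hj
  · exact absurd hj (hy j hji)

theorem mem_poles_iff (h : D.IsSpliceOf σ s) {i : Fin s.n} {t : UnitAddCircle} :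
    t ∈ (s.curve i).poles ↔
      ∃ c κ, ¬ D.IsOrientedSplice c (σ c) ∧ (s.curve i).toFun t = D.polePoint c κ := by
  simp only [h.mem_poles, exists_and_left, exists_polePoint_eq_iff]

theorem kind_eq (h : D.IsSpliceOf σ s) {i : Fin s.n} {t : UnitAddCircle}
    (ht : t ∈ (s.curve i).poles) {c : Fin D.m} {κ : PoleKind}
    (hc : (s.curve i).toFun t = D.polePoint c κ) : (s.curve i).kind t = κ := by
  cases κ
  · exact h.sink i t ht c hc
  · exact h.source i t ht c hc

theorem eventually_mem_side (h : D.IsSpliceOf σ s) {i : Fin s.n} {t : UnitAddCircle}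
    (ht : t ∈ (s.curve i).poles) {c : Fin D.m} {κ : PoleKind}
    (hc : (s.curve i).toFun t = D.polePoint c κ) :
    ∀ᶠ y in 𝓝 ((s.curve i).toFun t), y ∈ (s.curve i).side t ↔ y ∈ D.chart c '' middleRegion :=
  h.side i t ht c (D.exists_polePoint_eq_iff.1 ⟨κ, hc⟩)

theorem exists_curve_eq (h : D.IsSpliceOf σ s) {c : Fin D.m}
    (hc : ¬ D.IsOrientedSplice c (σ c)) (κ : PoleKind) :
    ∃ x : Σ _ : Fin s.n, UnitAddCircle, (s.curve x.1).toFun x.2 = D.polePoint c κ := by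
  obtain ⟨p, hp, -, hu⟩ := D.exists_polePoint c κ
  have hmem : D.polePoint c κ ∈ s.carrier := by
    rw [h.carrier_eq, hp, chart_mem_splicedCarrier, spliceArcs, if_neg hc]
    exact hu
  obtain ⟨i, t, ht⟩ := mem_iUnion.1 hmem
  exact ⟨⟨i, t⟩, ht⟩

theorem middle_disjoint (h : D.IsSpliceOf σ s) {c : Fin D.m}
    (hc : ¬ D.IsOrientedSplice c (σ c)) (i : Fin s.n) :
    Disjoint (D.chart c '' middleRegion) (s.curve i).carrier := by
  rw [Set.disjoint_left]
  rintro _ ⟨p, hp, rfl⟩ hi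
  have hmem : D.chart c p ∈ s.carrier := mem_iUnion.2 ⟨i, hi⟩
  rw [h.carrier_eq, chart_mem_splicedCarrier, spliceArcs, if_neg hc] at hmem
  exact (ne_of_lt (show |p.1 + p.2| < max |p.1 - p.2| 1 from hp)) hmem

/-- The region between the two arcs at the crossing which creates a pole at `x` lies in `U`. -/
def MiddleIn (D : LinkDiagram F) (U : Set F) (x : F) : Prop :=
  ∃ c κ, x = D.polePoint c κ ∧ D.chart c '' middleRegion ⊆ U

theorem middleIn_polePoint {U : Set F} {c : Fin D.m} {κ : PoleKind} :
    MiddleIn D U (D.polePoint c κ) ↔ D.chart c '' middleRegion ⊆ U := by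
  refine ⟨?_, fun h => ⟨c, κ, rfl, h⟩⟩
  rintro ⟨c', κ', h, hU⟩
  obtain ⟨rfl, -⟩ := D.polePoint_injective h
  exact hU

open Classical in
/-- The poles with a middle region in `U` cancel, since each such region contains one pole of each
kind. -/
theorem sum_sum_eq_zero (h : D.IsSpliceOf σ s) (U : Set F) :
    ∑ i, ∑ t ∈ (s.curve i).poles,
      (if MiddleIn D U ((s.curve i).toFun t) then PoleKind.sign ((s.curve i).kind t) else 0) =
        0 := by
  rw [Finset.sum_sigma']
  -- Poles of the state correspond bijectively to pairs of a crossing spliced against the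
  -- orientations and a kind; summing over the kinds first gives `1 - 1` at each crossing.
  set T : Finset (Fin D.m × PoleKind) :=
    (Finset.univ.filter fun c => ¬ D.IsOrientedSplice c (σ c)) ×ˢ {.sink, .source}
  have hT : ∀ x ∈ T, ¬ D.IsOrientedSplice x.1 (σ x.1) := fun x hx =>
    (Finset.mem_filter.1 (Finset.mem_product.1 hx).1).2
  have hi : ∀ x (hx : x ∈ T), _ := fun x hx => (h.exists_curve_eq (hT x hx) x.2).choose_spec
  have hp : ∀ x (hx : x ∈ T), _ := fun x hx => h.mem_poles_iff.2 ⟨x.1, x.2, hT x hx, hi x hx⟩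
  rw [← Finset.sum_bij (s := T)
    (f := fun x => if D.chart x.1 '' middleRegion ⊆ U then PoleKind.sign x.2 else 0)
    (fun x hx => (h.exists_curve_eq (hT x hx) x.2).choose)]
  · rw [Finset.sum_product]
    refine Finset.sum_eq_zero fun c _ => ?_
    rw [Finset.sum_pair (by simp)]
    split_ifs <;> simp [PoleKind.sign]
  · exact fun x hx => Finset.mem_sigma.2 ⟨Finset.mem_univ _, hp x hx⟩
  · intro x hx y hy hxy
    have h1 := hi x hx
    rw [hxy, hi y hy] at h1
    obtain ⟨h2, h3⟩ := D.polePoint_injective h1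
    exact Prod.ext h2.symm h3.symm
  · rintro ⟨j, t⟩ hjt
    obtain ⟨c, κ, hc, hjc⟩ := h.mem_poles_iff.1 (Finset.mem_sigma.1 hjt).2
    have hcT : (c, κ) ∈ T := by
      refine Finset.mem_product.2 ⟨Finset.mem_filter.2 ⟨Finset.mem_univ _, hc⟩, ?_⟩
      cases κ <;> simp
    exact ⟨(c, κ), hcT, s.eq_of_toFun_eq ((hi _ hcT).trans hjc.symm)⟩
  · intro x hx
    simp only [hi x hx, middleIn_polePoint, h.kind_eq (hp x hx) (hi x hx)]

/-- A middle region which touches an open set on a side of a curve of the state lies in it. -/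
theorem middle_subset (h : D.IsSpliceOf σ s) {i : Fin s.n} {U V : Set F}
    (hsep : IsSeparation (s.curve i).carrier U V) {c : Fin D.m} {κ : PoleKind}
    (hc : ¬ D.IsOrientedSplice c (σ c)) (hU : D.polePoint c κ ∈ U) :
    D.chart c '' middleRegion ⊆ U := by
  refine (subset_left_or_subset_right hsep.isOpen_left hsep.isOpen_right hsep.disjoint
    hsep.compl_eq (D.isPreconnected_middle c) (h.middle_disjoint hc i)).resolve_right fun hV => ?_
  obtain ⟨y, hyU, hy⟩ := mem_closure_iff_nhds.1 (D.polePoint_mem_closure c κ) _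
    (hsep.isOpen_left.mem_nhds hU)
  exact Set.disjoint_left.1 hsep.disjoint hyU (hV hy)

theorem poleOn_of_middle_subset (h : D.IsSpliceOf σ s) {i : Fin s.n} {U V : Set F}
    (hsep : IsSeparation (s.curve i).carrier U V) {t : UnitAddCircle}
    (ht : t ∈ (s.curve i).poles) {c : Fin D.m} {κ : PoleKind}
    (hc : (s.curve i).toFun t = D.polePoint c κ) (hU : D.chart c '' middleRegion ⊆ U) :
    (s.curve i).PoleOn U t := by
  refine ((s.curve i).poleOn_or hsep ht).resolve_right fun hV => ?_
  obtain ⟨y, ⟨h1, h2⟩, hy⟩ := mem_closure_iff_nhds.1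
    (hsep.subset_closure_right (mem_range_self t)) _ (hV.and (h.eventually_mem_side ht hc))
  exact Set.disjoint_left.1 hsep.disjoint (hU (h2.1 (h1.2 hy))) hy

/-- This turns the local position of a pole into the position of a whole region, a condition shared
by both poles of the crossing even if they lie on different curves. -/
theorem poleOn_iff_middleIn (h : D.IsSpliceOf σ s) {i : Fin s.n} {U V : Set F}
    (hsep : IsSeparation (s.curve i).carrier U V) {t : UnitAddCircle}
    (ht : t ∈ (s.curve i).poles) :
    (s.curve i).PoleOn U t ↔ MiddleIn D U ((s.curve i).toFun t) := by
  obtain ⟨c, κ, hc, htc⟩ := h.mem_poles_iff.1 ht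
  rw [htc, middleIn_polePoint]
  refine ⟨fun hU => ?_, h.poleOn_of_middle_subset hsep ht htc⟩
  refine (subset_left_or_subset_right hsep.isOpen_left hsep.isOpen_right hsep.disjoint
    hsep.compl_eq (D.isPreconnected_middle c) (h.middle_disjoint hc i)).resolve_right fun hV => ?_
  exact (s.curve i).not_poleOn_both hsep hU (h.poleOn_of_middle_subset hsep.symm ht htc hV)

/-- The poles on one side of a separating curve of a surface pole state balance. -/
theorem excess_eq_zero (h : D.IsSpliceOf σ s) {i : Fin s.n} {U V : Set F}
    (hsep : IsSeparation (s.curve i).carrier U V) : (s.curve i).excess U = 0 := by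
  classical
  have hsum := h.sum_sum_eq_zero U
  rw [Finset.sum_eq_single i ?_ (by simp)] at hsum
  · rw [← hsum, PoleCurve.excess]
    refine Finset.sum_congr rfl fun t ht => ?_
    simp only [h.poleOn_iff_middleIn hsep ht]
  -- A curve `j` other than `i` is connected and misses curve `i`: in `U` all its poles count and
  -- their signs cancel, in `V` none counts.
  · intro j _ hji
    rcases subset_left_or_subset_right hsep.isOpen_left hsep.isOpen_right hsep.disjoint
      hsep.compl_eq (s.curve j).isConnected_carrier.isPreconnected (s.disjoint j i hji)
      with hj | hj
    · rw [← (s.curve j).sum_sign_eq_zero]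
      refine Finset.sum_congr rfl fun t ht => if_pos ?_
      obtain ⟨c, κ, hc, htc⟩ := h.mem_poles_iff.1 ht
      rw [htc, middleIn_polePoint]
      exact h.middle_subset hsep hc (htc ▸ hj (mem_range_self t))
    · refine Finset.sum_eq_zero fun t ht => if_neg ?_
      obtain ⟨c, κ, hc, htc⟩ := h.mem_poles_iff.1 ht
      rw [htc, middleIn_polePoint]
      intro hU
      have hV := h.middle_subset hsep.symm hc (htc ▸ hj (mem_range_self t))
      have hne : (D.chart c '' middleRegion).Nonempty :=
        closure_nonempty_iff.1 ⟨_, D.polePoint_mem_closure c κ⟩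
      obtain ⟨y, hy⟩ := hne
      exact Set.disjoint_left.1 hsep.disjoint (hU hy) (hV hy)

end IsSpliceOf
end LinkDiagram

end TwistedLink

/-! ### The main theorem -/

theorem theorem2 {F : Type*} [TopologicalSpace F] [T2Space F] [CompactSpace F]
    [ChartedSpace (EuclideanSpace ℝ (Fin 2)) F]
    (D : TwistedLink.LinkDiagram F) (s : TwistedLink.PoleCurveLink F)
    (hs : D.IsSurfacePoleState s)
    (i : Fin s.n) (k : ℕ) (hk : (s.curve i).HasIndex k) (hpos : 0 < k) :
    TwistedLink.IsNonSeparating (s.curve i).carrier := by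
  obtain ⟨σ, hσ⟩ := hs
  obtain ⟨l, hred, hirr, hcard⟩ := hk
  have : LocallyConnectedSpace F :=
    ChartedSpace.locallyConnectedSpace (EuclideanSpace ℝ (Fin 2)) F
  have hflat := fun x hx => hσ.exists_isFlatChart i (x := x) hx
  by_contra hns
  obtain ⟨U, V, hsep⟩ := TwistedLink.exists_isSeparation (s.curve i).isConnected_carrier
    (s.curve i).isCompact_carrier.isClosed hflat hns
  obtain ⟨hl, hex⟩ := TwistedLink.PoleCurve.reflTransGen_excess_eq hsep hred
  have hcar : l.carrier = (s.curve i).carrier := by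
    rw [TwistedLink.PoleCurve.carrier, hl, TwistedLink.PoleCurve.carrier]
  have hemp := hirr.poles_eq_empty (hcar ▸ hsep) (hcar ▸ hflat)
    (hex.trans (hσ.excess_eq_zero hsep))
  rw [hemp, Finset.card_empty] at hcard
  omega
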